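/- Let $N\ge 1$, $L\ge 2$, and let $n_0,n_1,\dots,n_L$ be layer widths, where $d=n_0$ is the input dimension and $m=n_L$ the output dimension. Let $X\in\mathbb{R}^{N\times d}$ be a data matrix whose $N$ rows (the training samples) are pairwise distinct, let $\sigma:\mathbb{R}\to\mathbb{R}$ be continuous, and let $\varphi:\mathbb{R}^{N\times m}\to\mathbb{R}$ be convex. For parameters $\theta=(W_l,b_l)_{l=1}^L\in\Omega$, with $W_l\in\mathbb{R}^{n_{l-1}\times n_l}$ and $b_l\in\mathbb{R}^{n_l}$, put $F_0=X$, $F_k=\sigma(F_{k-1}W_k+\mathbf{1}_Nb_k^T)$ for $1\le k\le L-1$ (with $\sigma$ applied entrywise), $F_L=F_{L-1}W_L+\mathbf{1}_Nb_L^T$, and let $\Phi(\theta)=\varphi(F_L(\theta))$ be the training loss $\Phi:\Omega\to\mathbb{R}$. Call a set $S$ connected if any two points of $S$ can be joined by a continuous curve in $S$ (so that the empty set is connected); a connected component of a set is a nonempty maximal connected subset of it. Assume that 1. $\sigma$ is strictly monotonic and $\sigma(\mathbb{R})=\mathbb{R}$; 2. there do not exist non-zero reals $\lambda_1,\dots,\lambda_p$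 and pairwise distinct non-zero reals $a_1,\dots,a_p$ such that $\sigma(x)=\sum_{i=1}^p\lambda_i\,\sigma(x-a_i)$ for every $x\in\mathbb{R}$; 3. $n_1\ge 2N$ and $n_2>n_3>\dots>n_L$ (no condition on $n_2$ if $L=2$). Then for every $\alpha\in\mathbb{R}$ the sublevel set $\{\theta\in\Omega:\Phi(\theta)\le\alpha\}$ is connected, and every connected component of the level set $\{\theta\in\Omega:\Phi(\theta)=\alpha\}$ is unbounded. In particular, all global minima lie in one unique valley: the set of global minimizers of $\Phi$ on $\Omega$ is connected, and for every $\alpha\in\mathbb{R}$ the strict sublevel set $\{\theta\in\Omega:\Phi(\theta)<\alpha\}$ has at most one connected component (local valley), which, if there is one, contains all global minimizers of $\Phi$. -/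

import Mathlib

namespace DeepNet

/-- A set is connected if any two of its points are joined by a continuous curve
`r : [0,1] → S` inside it (the empty set is allowed). -/
def CurveConnected {E : Type*} [TopologicalSpace E] (S : Set E) : Prop :=
  ∀ x ∈ S, ∀ y ∈ S, JoinedIn S x y

/-- `C` is a (nonempty) connected component of `S`: a maximal connected subset of `S`. -/
def IsComponent {E : Type*} [TopologicalSpace E] (S C : Set E) : Prop :=
  C.Nonempty ∧ Maximal (fun D : Set E => D ⊆ S ∧ CurveConnected D) C

/-- `σ` is strictly monotonic (increasing or decreasing) and `σ(ℝ) = ℝ`. -/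
def StrictlyMonotoneOnto (σ : ℝ → ℝ) : Prop :=
  (StrictMono σ ∨ StrictAnti σ) ∧ Set.range σ = Set.univ

/-- There are no non-zero `λ_i` and pairwise distinct non-zero `a_i`, `i = 1, …, p`, with
`σ(x) = ∑ i, λ_i σ(x - a_i)` for every real `x`. -/
def NoTranslateRelation (σ : ℝ → ℝ) : Prop :=
  ¬ ∃ (p : ℕ) (c a : Fin p → ℝ),
      (∀ i, c i ≠ 0) ∧ (∀ i, a i ≠ 0) ∧ (∀ i j, i ≠ j → a i ≠ a j) ∧
        ∀ x : ℝ, σ x = ∑ i, c i * σ (x - a i)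

/-- The parameter space `Ω = Ω₁ × ⋯ × Ω_L` of a network with `L` layers, layer `k` having
width `n k` (and `n 0` the input dimension, `n L` the output dimension). For `θ : Params L n`, the
entry `θ l` is the pair of weight matrix and bias vector of layer `l + 1`. Only the values
`n 0, …, n L` matter. -/
abbrev Params (L : ℕ) (n : ℕ → ℕ) : Type :=
  (l : Fin L) → Matrix (Fin (n l)) (Fin (n (l + 1))) ℝ × (Fin (n (l + 1)) → ℝ)

/-- The output `F_k(θ)` of layer `k` on the data matrix `X`, whose rows are the samples:
`F_0 = X`, `F_k = σ(F_{k-1} W_k + 1 b_kᵀ)` for `1 ≤ k ≤ L - 1` with `σ` applied entrywise, and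
`F_L = F_{L-1} W_L + 1 b_Lᵀ`. -/
def layerOutput {N L : ℕ} {n : ℕ → ℕ} (σ : ℝ → ℝ) (X : Matrix (Fin N) (Fin (n 0)) ℝ)
    (θ : Params L n) : (k : ℕ) → k ≤ L → Matrix (Fin N) (Fin (n k)) ℝ
  | 0, _ => X
  | k + 1, h =>
      let A : Matrix (Fin N) (Fin (n (k + 1))) ℝ :=
        layerOutput σ X θ k (Nat.le_of_succ_le h) * (θ ⟨k, h⟩).1
          + Matrix.of (fun _ j => (θ ⟨k, h⟩).2 j)
      if k + 1 = L then A else A.map σ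

/-- The training loss `Φ(θ) = φ(F_L(θ))`. -/
def loss {N L : ℕ} {n : ℕ → ℕ} (σ : ℝ → ℝ) (X : Matrix (Fin N) (Fin (n 0)) ℝ)
    (φ : Matrix (Fin N) (Fin (n L)) ℝ → ℝ) (θ : Params L n) : ℝ :=
  φ (layerOutput σ X θ L le_rfl)

/-- The `α`-sublevel set of `Φ`. -/
def sublevelSet {E : Type*} (Φ : E → ℝ) (α : ℝ) : Set E := {θ | Φ θ ≤ α}

/-- The strict `α`-sublevel set of `Φ`. -/
def strictSublevelSet {E : Type*} (Φ : E → ℝ) (α : ℝ) : Set E := {θ | Φ θ < α}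

/-- The `α`-level set of `Φ`. -/
def levelSet {E : Type*} (Φ : E → ℝ) (α : ℝ) : Set E := {θ | Φ θ = α}

/-- The set of global minimizers of `Φ`. -/
def globalMinima {E : Type*} (Φ : E → ℝ) : Set E := {θ | ∀ θ', Φ θ ≤ Φ θ'}

/-- A set of parameters is bounded if all weights and biases are bounded by a common constant
(which is boundedness in any norm, as the parameter space is finite-dimensional). -/
def BoundedParams {L : ℕ} {n : ℕ → ℕ} (C : Set (Params L n)) : Prop :=
  ∃ R : ℝ, ∀ θ ∈ C, ∀ l : Fin L,
    (∀ i j, |(θ l).1 i j| ≤ R) ∧ (∀ j, |(θ l).2 j| ≤ R)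

end DeepNet

/-! Sublevel sets and strict sublevel sets of `Φ` are preimages of convex sets under `θ ↦ F_L(θ)`,
so it suffices that such preimages are curve-connected. This is proved by lifting curves backwards
through the layers. The objects pulled back are sets of pairs (output of layer `k`, all parameters)
that do not constrain the parameters of the first `k` layers.

Through a layer of decreasing width (`CurveConnected.layer_preimage`), `W` is first made injective
with `F * W` fixed. Injective matrices with fewer columns than rows form a path-connected set and
have continuous left inverses, so a curve of outputs lifts to a curve of inputs. Through the first
two layers (`CurveConnected.first_layers_preimage`), `2 * N` neurons leave room to move the hidden
layer, with the output fixed, to a standard position whose features span `ℝ^N`. Such features exist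
because `σ` satisfies no translate relation (`span_translates_eq_top`). A right inverse of the
feature matrix then solves for the second weight matrix.

For level sets, more than `N` hidden neurons make one of them redundant. Its bias can be moved
arbitrarily far at constant loss. -/

namespace DeepNet

open Set Matrix

/-! ### Paths as continuous functions on the real line. -/

section Paths

variable {E B : Type*} [TopologicalSpace E] [TopologicalSpace B]

/-- Extending a path constantly beyond its endpoints keeps it in `S`. Curves on all of `ℝ` can be
combined by explicit formulas, without the unit interval. -/
theorem joinedIn_iff_exists_continuous {S : Set E} {x y : E} :
    JoinedIn S x y ↔ ∃ f : ℝ → E, Continuous f ∧ f 0 = x ∧ f 1 = y ∧ ∀ t, f t ∈ S := by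
  constructor
  · rintro ⟨γ, hγ⟩
    refine ⟨γ.extend, γ.continuous_extend, γ.extend_zero, γ.extend_one, fun t => ?_⟩
    obtain ⟨s, hs⟩ : γ.extend t ∈ range γ := by
      rw [← γ.extend_range]; exact mem_range_self t
    exact hs ▸ hγ s
  · rintro ⟨f, hf, h0, h1, hS⟩
    refine JoinedIn.ofLine hf.continuousOn h0 h1 ?_
    rintro _ ⟨t, -, rfl⟩
    exact hS t

/-- Asking for the whole line costs nothing here: in the applications `S` is cut out by an equation
that holds for every real `t`. -/
theorem joinedIn_segment [AddCommGroup E] [Module ℝ E] [ContinuousAdd E] [ContinuousSMul ℝ E]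
    {S : Set E} {x y : E} (h : ∀ t : ℝ, x + t • (y - x) ∈ S) : JoinedIn S x y :=
  joinedIn_iff_exists_continuous.2
    ⟨fun t => x + t • (y - x), by fun_prop, by simp, by simp, h⟩

theorem JoinedIn.map_of_mapsTo {S : Set E} {T : Set B} {x y : E} (h : JoinedIn S x y) {f : E → B}
    (hf : Continuous f) (hST : MapsTo f S T) : JoinedIn T (f x) (f y) := by
  obtain ⟨g, hg, h0, h1, hS⟩ := joinedIn_iff_exists_continuous.1 h
  exact joinedIn_iff_exists_continuous.2
    ⟨f ∘ g, hf.comp hg, by simp [h0], by simp [h1], fun t => hST (hS t)⟩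

end Paths

/-! ### Matrices with independent columns: connectedness and left inverses. -/

section InjectiveMatrices

theorem exists_notMem_of_ne_top {V : Type*} [AddCommGroup V] [Module ℝ V] {p q : Submodule ℝ V}
    (hp : p ≠ ⊤) (hq : q ≠ ⊤) : ∃ u, u ∉ p ∧ u ∉ q := by
  by_contra! h
  obtain ⟨i, hi⟩ := Subspace.exists_eq_top_of_iUnion_eq_univ (k := ℝ)
    (p := fun b : Bool => if b then p else q) (by
      ext u
      by_cases hu : u ∈ p
      · simp [hu]
      · simp [h u hu])
  cases i <;> simp_all

theorem linearIndependent_iff_notMem_span_compl {ι V : Type*} [AddCommGroup V] [Module ℝ V]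
    {w : ι → V} (j : ι) :
    LinearIndependent ℝ w ↔
      LinearIndepOn ℝ w {j}ᶜ ∧ w j ∉ Submodule.span ℝ (w '' {j}ᶜ) := by
  rw [← linearIndepOn_univ_iff, ← linearIndepOn_insert (by simp)]
  congr!
  ext i
  simp [em]

theorem update_image_compl {ι V : Type*} [DecidableEq ι] (w : ι → V) (j : ι) (u : V) :
    Function.update w j u '' {j}ᶜ = w '' {j}ᶜ :=
  image_congr fun _ hi => Function.update_of_ne hi _ _

theorem linearIndependent_update_iff {ι V : Type*} [DecidableEq ι] [AddCommGroup V] [Module ℝ V]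
    {w : ι → V} (j : ι) (u : V) :
    LinearIndependent ℝ (Function.update w j u) ↔
      LinearIndepOn ℝ w {j}ᶜ ∧ u ∉ Submodule.span ℝ (w '' {j}ᶜ) := by
  rw [linearIndependent_iff_notMem_span_compl j, update_image_compl, Function.update_self]
  have : LinearIndepOn ℝ (Function.update w j u) {j}ᶜ ↔ LinearIndepOn ℝ w {j}ᶜ :=
    linearIndepOn_congr fun i hi => Function.update_of_ne hi _ _
  rw [this]

variable {ι V : Type*} [Fintype ι] [AddCommGroup V] [Module ℝ V] [FiniteDimensional ℝ V]

/-- Codimension at least two is what makes the complement of the span path-connected; a hyperplane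
would separate the space. -/
theorem card_lt_finrank_quotient_span (hι : Fintype.card ι < Module.finrank ℝ V) (w : ι → V)
    (j : ι) : 1 < Module.finrank ℝ (V ⧸ Submodule.span ℝ (w '' {j}ᶜ)) := by
  classical
  have h1 := Submodule.finrank_quotient_add_finrank (Submodule.span ℝ (w '' {j}ᶜ))
  have h2 : Module.finrank ℝ (Submodule.span ℝ (w '' {j}ᶜ)) ≤ Fintype.card ι - 1 := by
    have : w '' {j}ᶜ = ((Finset.univ.erase j).image w : Finset V) := by
      ext; simp
    rw [this]
    refine (finrank_span_finset_le_card _).trans (Finset.card_image_le.trans ?_)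
    simp
  have h3 : 0 < Fintype.card ι := Fintype.card_pos_iff.2 ⟨j⟩
  omega

variable [TopologicalSpace V] [IsTopologicalAddGroup V] [ContinuousSMul ℝ V]

theorem joinedIn_linearIndependent_update [DecidableEq ι] (hι : Fintype.card ι < Module.finrank ℝ V) {w : ι → V}
    (hw : LinearIndependent ℝ w) {j : ι} {u : V} (hu : u ∉ Submodule.span ℝ (w '' {j}ᶜ)) :
    JoinedIn {w : ι → V | LinearIndependent ℝ w} w (Function.update w j u) := by
  have hw' := (linearIndependent_iff_notMem_span_compl j).1 hw
  have hc : IsPathConnected ((Submodule.span ℝ (w '' {j}ᶜ) : Set V)ᶜ) := by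
    apply isPathConnected_compl_of_one_lt_codim
    rw [← Module.finrank_eq_rank]
    exact_mod_cast card_lt_finrank_quotient_span hι w j
  have hJ := hc.joinedIn _ hw'.2 _ hu
  have := JoinedIn.map_of_mapsTo hJ (f := fun u => Function.update w j u)
    (T := {w : ι → V | LinearIndependent ℝ w}) (by fun_prop) (fun v hv =>
      (linearIndependent_update_iff j v).2 ⟨hw'.1, hv⟩)
  simpa using this

/-- In a space of dimension greater than `card ι`, the linearly independent families indexed by
`ι` form a path-connected set. -/
theorem joinedIn_linearIndependent (hι : Fintype.card ι < Module.finrank ℝ V) {w w' : ι → V}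
    (hw : LinearIndependent ℝ w) (hw' : LinearIndependent ℝ w') :
    JoinedIn {w : ι → V | LinearIndependent ℝ w} w w' := by
  classical
  suffices h : ∀ (m : ℕ) (w w' : ι → V), LinearIndependent ℝ w → LinearIndependent ℝ w' →
      (Finset.univ.filter fun i => ¬ w i = w' i).card = m →
      JoinedIn {w : ι → V | LinearIndependent ℝ w} w w' from h _ w w' hw hw' rfl
  intro m
  induction m with
  | zero =>
    intro w w' hw hw' h
    have : w = w' := by
      ext1 i
      by_contra hi
      exact Finset.notMem_empty i (Finset.card_eq_zero.1 h ▸ by simp [hi])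
    exact this ▸ JoinedIn.refl hw
  | succ m ih =>
    intro w w' hw hw' h
    obtain ⟨j, hj⟩ := Finset.card_pos.1 (by rw [h]; exact Nat.succ_pos m)
    -- A single `u` admissible for both families exists because two proper subspaces do not cover
    -- `V`. Moving both `j`-th vectors to `u` leaves one disagreement fewer.
    obtain ⟨u, hu, hu'⟩ := exists_notMem_of_ne_top
      (p := Submodule.span ℝ (w '' {j}ᶜ)) (q := Submodule.span ℝ (w' '' {j}ᶜ))
      (fun h => (linearIndependent_iff_notMem_span_compl j).1 hw |>.2 (h ▸ Submodule.mem_top))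
      (fun h => (linearIndependent_iff_notMem_span_compl j).1 hw' |>.2 (h ▸ Submodule.mem_top))
    have h1 := joinedIn_linearIndependent_update hι hw hu
    have h2 := joinedIn_linearIndependent_update hι hw' hu'
    refine h1.trans ((ih _ _ h1.target_mem h2.target_mem ?_).trans h2.symm)
    have : (Finset.univ.filter fun i => ¬ Function.update w j u i = Function.update w' j u i)
        = (Finset.univ.filter fun i => ¬ w i = w' i).erase j := by
      ext i
      by_cases hi : i = j
      · subst hi; simp
      · simp [hi]
    rw [this, Finset.card_erase_of_mem hj, h]
    rfl

variable {p q : ℕ}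

/-- The strict decrease of the widths enters here: for `q = p ≥ 1` the sign of the determinant would
disconnect the set. -/
theorem joinedIn_injective_mulVec (hpq : q < p) {W W' : Matrix (Fin p) (Fin q) ℝ}
    (hW : Function.Injective W.mulVec) (hW' : Function.Injective W'.mulVec) :
    JoinedIn {W : Matrix (Fin p) (Fin q) ℝ | Function.Injective W.mulVec} W W' := by
  rw [Matrix.mulVec_injective_iff] at hW hW'
  have := JoinedIn.map_of_mapsTo (joinedIn_linearIndependent (by simpa using hpq) hW hW')
    (f := fun w : Fin q → Fin p → ℝ => Matrix.transpose (Matrix.of w))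
    (T := {W : Matrix (Fin p) (Fin q) ℝ | Function.Injective W.mulVec})
    (by
      refine continuous_matrix fun i j => ?_
      simp only [transpose_apply, of_apply]
      fun_prop) (fun w hw => by
      simp only [mem_ofPred_eq, Matrix.mulVec_injective_iff]
      exact hw)
  exact this

/-- The left inverse `(Wᵀ W)⁻¹ Wᵀ` of a matrix with independent columns. -/
noncomputable def leftInv (W : Matrix (Fin p) (Fin q) ℝ) : Matrix (Fin q) (Fin p) ℝ :=
  (Wᵀ * W)⁻¹ * Wᵀ

theorem isUnit_det_transpose_mul_self {W : Matrix (Fin p) (Fin q) ℝ}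
    (hW : Function.Injective W.mulVec) : IsUnit (Wᵀ * W).det := by
  have := (Matrix.PosDef.conjTranspose_mul_self W hW).det_pos
  rw [Matrix.conjTranspose_eq_transpose_of_trivial] at this
  exact this.ne'.isUnit

theorem leftInv_mul {W : Matrix (Fin p) (Fin q) ℝ} (hW : Function.Injective W.mulVec) :
    leftInv W * W = 1 := by
  rw [leftInv, Matrix.mul_assoc, Matrix.nonsing_inv_mul _ (isUnit_det_transpose_mul_self hW)]

/-- The inverse of the Gram matrix is its adjugate over a nonvanishing determinant. -/
theorem continuous_leftInv {X : Type*} [TopologicalSpace X] {W : X → Matrix (Fin p) (Fin q) ℝ}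
    (hc : Continuous W) (hW : ∀ x, Function.Injective (W x).mulVec) :
    Continuous fun x => leftInv (W x) := by
  have h1 : Continuous fun x => (W x)ᵀ * W x := hc.matrix_transpose.matrix_mul hc
  refine Continuous.matrix_mul ?_ hc.matrix_transpose
  simp only [Matrix.inv_def, Ring.inverse_eq_inv']
  exact (h1.matrix_det.inv₀ fun x => (isUnit_det_transpose_mul_self (hW x)).ne_zero).smul
    h1.matrix_adjugate

/-- Along a path on which the product `F * W` is constant, `W` can be made to have independent
columns. -/
theorem exists_joinedIn_injective {N : ℕ} (hpq : q ≤ p) (F : Matrix (Fin N) (Fin p) ℝ)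
    (W : Matrix (Fin p) (Fin q) ℝ) :
    ∃ F' W', Function.Injective (Matrix.mulVec W') ∧
      JoinedIn {x : Matrix (Fin N) (Fin p) ℝ × Matrix (Fin p) (Fin q) ℝ | x.1 * x.2 = F * W}
        (F, W) (F', W') := by
  classical
  set f := W.mulVecLin with hf
  obtain ⟨C, hC⟩ := Submodule.exists_isCompl (LinearMap.range f)
  obtain ⟨K, hK⟩ := Submodule.exists_isCompl (LinearMap.ker f)
  have hdim : Module.finrank ℝ (LinearMap.ker f) ≤ Module.finrank ℝ C := by
    have h1 := Submodule.finrank_add_eq_of_isCompl hC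
    have h2 := LinearMap.finrank_range_add_finrank_ker f
    simp only [Module.finrank_fin_fun] at h1 h2
    omega
  obtain ⟨g, hg⟩ := lift_rank_le_iff_exists_linearMap.1
    (show Cardinal.lift.{0} (Module.rank ℝ (LinearMap.ker f)) ≤
      Cardinal.lift.{0} (Module.rank ℝ C) by
        rw [Cardinal.lift_id, Cardinal.lift_id, ← Module.finrank_eq_rank,
          ← Module.finrank_eq_rank]
        exact_mod_cast hdim)
  -- `V` embeds the kernel of `W` into a complement `C` of its range, which is large enough as `q ≤
  -- p`; hence `W + V` is injective. The projection `P` onto the range along `C` fixes `W` and kills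
  -- `V`, so passing from `F` to `F * P` and then from `W` to `W + V` preserves the product.
  let V : (Fin q → ℝ) →ₗ[ℝ] (Fin p → ℝ) :=
    C.subtype ∘ₗ g ∘ₗ (LinearMap.ker f).projectionOnto K hK
  let P := (LinearMap.range f).projection C hC
  have hPW : LinearMap.toMatrix' P * W = W := by
    apply Matrix.toLin'.injective
    rw [Matrix.toLin'_mul, Matrix.toLin'_toMatrix']
    exact LinearMap.ext fun y =>
      Submodule.projection_apply_of_mem_left hC (LinearMap.mem_range_self f y)
  have hPV : LinearMap.toMatrix' P * LinearMap.toMatrix' V = 0 := by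
    rw [← LinearMap.toMatrix'_comp]
    rw [show P ∘ₗ V = 0 from LinearMap.ext fun y => Submodule.projection_apply_right hC (g _),
      map_zero]
  refine ⟨F * LinearMap.toMatrix' P, W + LinearMap.toMatrix' V, ?_, ?_⟩
  · have : Function.Injective (f + V) := by
      refine (injective_iff_map_eq_zero _).2 fun x hx => ?_
      have h1 : f x = 0 := by
        have := congr_arg P hx
        rw [LinearMap.add_apply, map_add, map_zero] at this
        rwa [Submodule.projection_apply_of_mem_left hC (LinearMap.mem_range_self f x),
          show P (V x) = 0 from Submodule.projection_apply_right hC (g _), add_zero] at this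
      have h2 : V x = 0 := by simpa [h1] using hx
      have h3 := Submodule.projectionOnto_apply_left hK ⟨x, h1⟩
      simp only [V, LinearMap.comp_apply, h3] at h2
      have h4 : g ⟨x, h1⟩ = 0 := Subtype.ext h2
      exact congr_arg Subtype.val ((injective_iff_map_eq_zero g).1 hg _ h4)
    convert this using 1
    ext1 x
    rw [Matrix.add_mulVec, ← Matrix.toLin'_apply (LinearMap.toMatrix' V), Matrix.toLin'_toMatrix']
    rfl
  · refine JoinedIn.trans (y := (F * LinearMap.toMatrix' P, W)) ?_ ?_
    · refine joinedIn_segment fun t => ?_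
      simp [Matrix.add_mul, Matrix.sub_mul, Matrix.mul_assoc, hPW]
    · refine joinedIn_segment fun t => ?_
      simp [Matrix.mul_add, Matrix.mul_assoc, hPW, hPV]

end InjectiveMatrices

/-! ### Moving hidden neurons without changing the output. -/

section Neurons

variable {N p q : ℕ}

/-- If the columns of `U` with index in `J` span all columns, the rows of `W` outside `J` can be
moved to zero with `U * W` constant. -/
theorem exists_mul_eq_of_span {U : Matrix (Fin N) (Fin p) ℝ} {J : Set (Fin p)}
    (hJ : ∀ k, U.col k ∈ Submodule.span ℝ (U.col '' J)) (W : Matrix (Fin p) (Fin q) ℝ) :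
    ∃ W' : Matrix (Fin p) (Fin q) ℝ, (∀ k ∉ J, W' k = 0) ∧ U * W' = U * W := by
  classical
  have h : ∀ j, ∃ c : Fin p → ℝ, (∀ k ∉ J, c k = 0) ∧ U *ᵥ c = (U * W).col j := by
    intro j
    have : (U * W).col j ∈ Submodule.span ℝ (U.col '' J) := by
      have : (U * W).col j = ∑ k, W k j • U.col k := by
        ext i
        simp [Matrix.mul_apply, mul_comm]
      rw [this]
      exact Submodule.sum_mem _ fun k _ => Submodule.smul_mem _ _ (hJ k)
    obtain ⟨l, hl, hx⟩ := (Finsupp.mem_span_image_iff_linearCombination ℝ).1 this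
    refine ⟨l, fun k hk => ?_, ?_⟩
    · by_contra h0
      exact hk (hl (Finsupp.mem_support_iff.2 h0))
    · rw [← hx, Finsupp.linearCombination_apply, Finsupp.sum_fintype _ _ (by simp)]
      ext i
      simp [Matrix.mulVec, dotProduct, mul_comm]
  choose c hc hU using h
  refine ⟨Matrix.of fun k j => c j k, fun k hk => ?_, ?_⟩
  · ext j
    exact hc j k hk
  · ext i j
    exact congr_fun (hU j) i

variable {C : Type*}

/-- The matrix whose `k`-th column is the feature vector `v` at the parameter of neuron `k`. -/
def featureMatrix (v : C → Fin N → ℝ) (P : Fin p → C) : Matrix (Fin N) (Fin p) ℝ :=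
  Matrix.of fun i k => v (P k) i

theorem featureMatrix_mul_congr {v : C → Fin N → ℝ} {P P' : Fin p → C} {J : Set (Fin p)}
    {W : Matrix (Fin p) (Fin q) ℝ} (hW : ∀ k ∉ J, W k = 0) (hP : ∀ k ∈ J, P k = P' k) :
    featureMatrix v P * W = featureMatrix v P' * W := by
  ext i j
  simp only [Matrix.mul_apply, featureMatrix, Matrix.of_apply]
  refine Finset.sum_congr rfl fun k _ => ?_
  by_cases hk : k ∈ J
  · rw [hP k hk]
  · simp [hW k hk]

theorem exists_spanning_columns (U : Matrix (Fin N) (Fin p) ℝ) :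
    ∃ J : Finset (Fin p), J.card ≤ N ∧ ∀ k, U.col k ∈ Submodule.span ℝ (U.col '' J) := by
  classical
  obtain ⟨κ, a, ha, hspan, hli⟩ := exists_linearIndependent' ℝ U.col
  have : Finite κ := Finite.of_injective a ha
  have := Fintype.ofFinite κ
  refine ⟨Finset.univ.image a, ?_, fun k => ?_⟩
  · rw [Finset.card_image_of_injective _ ha]
    simpa using hli.fintype_card_le_finrank
  · rw [Finset.coe_image, Finset.coe_univ, image_univ, ← range_comp, hspan]
    exact Submodule.subset_span (mem_range_self k)

/-- Keep `e₀ i` unless it lies in `J`, and send the remaining indices outside `J` and the range of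
`e₀`; `2 * N ≤ p` gives enough room. The last condition ensures that `c` placed along `e` and along
`e₀` never conflicts. -/
theorem exists_embedding_disjoint {J : Finset (Fin p)} (hJ : J.card ≤ N) (hp : 2 * N ≤ p)
    {e₀ : Fin N → Fin p} (h₀ : Function.Injective e₀) :
    ∃ e : Fin N → Fin p, Function.Injective e ∧ (∀ i, e i ∉ J) ∧
      ∀ i j, e i = e₀ j → i = j := by
  classical
  let A := Finset.univ.filter fun i => e₀ i ∈ J
  let B := (J ∪ Finset.univ.image e₀)ᶜ
  have hcard : A.card ≤ B.card := by
    have h1 := Finset.card_union_add_card_inter J (Finset.univ.image e₀)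
    have h2 : (J ∩ Finset.univ.image e₀) = A.image e₀ := by
      ext k
      simp only [Finset.mem_inter, Finset.mem_image, Finset.mem_univ, true_and, A,
        Finset.mem_filter]
      constructor
      · rintro ⟨hk, i, rfl⟩
        exact ⟨i, hk, rfl⟩
      · rintro ⟨i, hi, rfl⟩
        exact ⟨hi, i, rfl⟩
    rw [h2, Finset.card_image_of_injective _ h₀, Finset.card_image_of_injective _ h₀,
      Finset.card_univ, Fintype.card_fin] at h1
    rw [Finset.card_compl, Fintype.card_fin]
    omega
  obtain ⟨g, hg⟩ : Nonempty (A ↪ B) :=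
    Function.Embedding.nonempty_of_card_le (by simpa using hcard)
  have hB : ∀ x : B, (x : Fin p) ∉ J ∧ ∀ i, e₀ i ≠ x := by
    intro x
    have := x.2
    simpa [B] using this
  have hA : ∀ i, i ∈ A ↔ e₀ i ∈ J := by simp [A]
  refine ⟨fun i => if h : i ∈ A then g ⟨i, h⟩ else e₀ i, fun i j hij => ?_, fun i => ?_,
    fun i j hij => ?_⟩
  · by_cases hi : i ∈ A <;> by_cases hj : j ∈ A <;> simp only [hi, hj, dif_pos, dif_neg,
      not_false_eq_true] at hij
    · simpa using hg (Subtype.ext hij)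
    · exact absurd hij.symm ((hB _).2 _)
    · exact absurd hij ((hB _).2 _)
    · exact h₀ hij
  · by_cases hi : i ∈ A
    · simpa only [hi, dif_pos] using (hB _).1
    · simpa only [hi, dif_neg, not_false_eq_true] using fun h => hi ((hA i).2 h)
  · by_cases hi : i ∈ A <;> simp only [hi, dif_pos, dif_neg, not_false_eq_true] at hij
    · exact absurd hij.symm ((hB _).2 _)
    · exact h₀ hij

variable [AddCommGroup C] [Module ℝ C] [TopologicalSpace C] [ContinuousAdd C]
  [ContinuousSMul ℝ C]

theorem joinedIn_snd_of_mul_eq (v : C → Fin N → ℝ) (P : Fin p → C)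
    {W W' : Matrix (Fin p) (Fin q) ℝ} {H : Matrix (Fin N) (Fin q) ℝ}
    (hW : featureMatrix v P * W = H) (hW' : featureMatrix v P * W' = H) :
    JoinedIn {x : (Fin p → C) × Matrix (Fin p) (Fin q) ℝ | featureMatrix v x.1 * x.2 = H}
      (P, W) (P, W') := by
  refine joinedIn_segment fun t => ?_
  simp [Matrix.mul_add, Matrix.mul_sub, hW, hW']

theorem joinedIn_fst_of_eqOn (v : C → Fin N → ℝ) {P P' : Fin p → C}
    {W : Matrix (Fin p) (Fin q) ℝ} {H : Matrix (Fin N) (Fin q) ℝ}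
    (hH : featureMatrix v P * W = H) {J : Set (Fin p)} (hW : ∀ k ∉ J, W k = 0)
    (hP : ∀ k ∈ J, P k = P' k) :
    JoinedIn {x : (Fin p → C) × Matrix (Fin p) (Fin q) ℝ | featureMatrix v x.1 * x.2 = H}
      (P, W) (P', W) := by
  refine joinedIn_segment fun t => ?_
  simp only [Prod.mk_sub_mk, sub_self, Prod.smul_mk, smul_zero, Prod.mk_add_mk, add_zero,
    mem_ofPred_eq]
  rw [← hH]
  exact featureMatrix_mul_congr hW fun k hk => by simp [hP k hk]

/-- With at least `2 * N` hidden neurons, the parameters of all neurons can be moved to prescribed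
ones, `c i` at the neurons `e₀ i` and `0` elsewhere, with `featureMatrix v P * W` constant. -/
theorem exists_joinedIn_extend (v : C → Fin N → ℝ) {c : Fin N → C}
    (hc : Submodule.span ℝ (range fun i => v (c i)) = ⊤) (hp : 2 * N ≤ p)
    {e₀ : Fin N → Fin p} (h₀ : Function.Injective e₀) (P : Fin p → C)
    (W : Matrix (Fin p) (Fin q) ℝ) :
    ∃ W', JoinedIn {x : (Fin p → C) × Matrix (Fin p) (Fin q) ℝ |
        featureMatrix v x.1 * x.2 = featureMatrix v P * W}
      (P, W) (Function.extend e₀ c 0, W') := by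
  obtain ⟨J, hJcard, hJ⟩ := exists_spanning_columns (featureMatrix v P)
  obtain ⟨e, he, heJ, hee⟩ := exists_embedding_disjoint hJcard hp h₀
  have hspan : ∀ {e : Fin N → Fin p} {Q : Fin p → C}, (∀ i, Q (e i) = c i) → ∀ k,
      (featureMatrix v Q).col k ∈ Submodule.span ℝ ((featureMatrix v Q).col '' range e) := by
    intro e Q hQ k
    have : (featureMatrix v Q).col '' range e = range fun i => v (c i) := by
      rw [← range_comp]
      congr 1
      ext i j
      simp [featureMatrix, hQ]
    rw [this, hc]
    exact Submodule.mem_top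
  -- Output weights alternate with neurons. With the weights supported on `J`, the neurons at `e`
  -- are free to become `c`. Once the weights are shifted to `range e`, those at `e₀` become `c`;
  -- once they are shifted to `range e₀`, all other neurons can be set to `0`.
  set P₁ := Function.extend e c P with hP₁
  set P₂ := Function.extend e₀ c P₁ with hP₂
  have hP₁e : ∀ i, P₁ (e i) = c i := fun i => he.extend_apply _ _ _
  have hP₂e₀ : ∀ i, P₂ (e₀ i) = c i := fun i => h₀.extend_apply _ _ _
  have hP₂e : ∀ i, P₂ (e i) = c i := by
    intro i
    by_cases h : ∃ j, e₀ j = e i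
    · obtain ⟨j, hj⟩ := h
      rw [← hj, hP₂e₀, hee i j hj.symm]
    · rw [hP₂, Function.extend_apply' _ _ _ h, hP₁e]
  obtain ⟨W₁, hW₁, hUW₁⟩ := exists_mul_eq_of_span hJ W
  have j₁ := joinedIn_snd_of_mul_eq v P rfl hUW₁
  have j₂ := joinedIn_fst_of_eqOn v (P' := P₁) j₁.target_mem hW₁ (fun k hk => by
    rw [hP₁, Function.extend_apply']
    rintro ⟨i, rfl⟩
    exact heJ i hk)
  obtain ⟨W₂, hW₂, hUW₂⟩ := exists_mul_eq_of_span (hspan hP₁e) W₁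
  have j₃ := joinedIn_snd_of_mul_eq v P₁ j₂.target_mem (hUW₂.trans j₂.target_mem)
  have j₄ := joinedIn_fst_of_eqOn v (P' := P₂) j₃.target_mem hW₂ (by
    rintro _ ⟨i, rfl⟩
    exact (hP₁e i).trans (hP₂e i).symm)
  obtain ⟨W₃, hW₃, hUW₃⟩ := exists_mul_eq_of_span (hspan hP₂e₀) W₂
  have j₅ := joinedIn_snd_of_mul_eq v P₂ j₄.target_mem (hUW₃.trans j₄.target_mem)
  have j₆ := joinedIn_fst_of_eqOn v (P' := Function.extend e₀ c 0) j₅.target_mem hW₃ (by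
    rintro _ ⟨i, rfl⟩
    exact (hP₂e₀ i).trans (h₀.extend_apply _ _ _).symm)
  exact ⟨W₃, j₁.trans (j₂.trans (j₃.trans (j₄.trans (j₅.trans j₆))))⟩

/-- With more than `N` hidden neurons, the output weights can be moved so that the parameters of
some neuron become irrelevant. -/
theorem exists_joinedIn_row_eq_zero (v : C → Fin N → ℝ) (hp : N < p) (P : Fin p → C)
    (W : Matrix (Fin p) (Fin q) ℝ) :
    ∃ k : Fin p, ∀ a : C, ∃ W', JoinedIn {x : (Fin p → C) × Matrix (Fin p) (Fin q) ℝ |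
        featureMatrix v x.1 * x.2 = featureMatrix v P * W}
      (P, W) (Function.update P k a, W') := by
  obtain ⟨J, hJcard, hJ⟩ := exists_spanning_columns (featureMatrix v P)
  obtain ⟨k, hk⟩ : ∃ k, k ∉ J := by
    by_contra! h
    rw [Finset.eq_univ_iff_forall.2 h, Finset.card_univ, Fintype.card_fin] at hJcard
    omega
  obtain ⟨W₁, hW₁, hUW₁⟩ := exists_mul_eq_of_span hJ W
  have j₁ := joinedIn_snd_of_mul_eq v P rfl hUW₁
  refine ⟨k, fun a => ⟨W₁, j₁.trans ?_⟩⟩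
  refine joinedIn_fst_of_eqOn v j₁.target_mem hW₁ fun l hl => ?_
  rw [Function.update_of_ne (ne_of_mem_of_not_mem hl hk)]

end Neurons

/-! ### Existence of neurons with spanning features. -/

section Features

variable {N d : ℕ}

/-- The outputs on all samples of a neuron with weights `c.1` and bias `c.2`. -/
def neuronFeature (σ : ℝ → ℝ) (X : Matrix (Fin N) (Fin d) ℝ) (c : (Fin d → ℝ) × ℝ) :
    Fin N → ℝ :=
  fun i => σ (X i ⬝ᵥ c.1 + c.2)

/-- Some linear functional is nonzero on all of the finitely many differences of distinct rows. -/
theorem exists_injective_dotProduct {X : Matrix (Fin N) (Fin d) ℝ}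
    (hX : ∀ i j, i ≠ j → X i ≠ X j) :
    ∃ w : Fin d → ℝ, Function.Injective fun i => X i ⬝ᵥ w := by
  obtain ⟨f, hf⟩ := Module.exists_dual_forall_apply_ne_zero (K := ℝ)
    (fun ij : {ij : Fin N × Fin N // ij.1 ≠ ij.2} => X ij.1.1 - X ij.1.2)
    (fun ij => sub_ne_zero.2 (hX _ _ ij.2))
  refine ⟨fun k => f (Pi.single k 1), fun i j hij => ?_⟩
  by_contra h
  refine hf ⟨(i, j), h⟩ ?_
  have hfx : ∀ x : Fin d → ℝ, f x = x ⬝ᵥ fun k => f (Pi.single k 1) := by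
    intro x
    rw [LinearMap.pi_apply_eq_sum_univ f x]
    simp only [dotProduct, smul_eq_mul]
    congr! 4 with k
    simp [Pi.single_apply, eq_comm]
  rw [map_sub, hfx (X i), hfx (X j)]
  exact sub_eq_zero.2 hij

/-- A nonzero functional vanishing on the span would give a linear relation between translates of
`σ`. Solving it for one term with nonzero coefficient yields the excluded identity. -/
theorem span_translates_eq_top {σ : ℝ → ℝ} (hσ : NoTranslateRelation σ) {t : Fin N → ℝ}
    (ht : Function.Injective t) :
    Submodule.span ℝ (range fun b : ℝ => fun i => σ (t i + b)) = ⊤ := by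
  by_contra hne
  obtain ⟨f, hf0, hf⟩ := Submodule.exists_le_ker_of_lt_top _ (lt_top_iff_ne_top.2 hne)
  set c : Fin N → ℝ := fun i => f (Pi.single i 1) with hc
  have hfx : ∀ x : Fin N → ℝ, f x = ∑ i, x i * c i := by
    intro x
    rw [LinearMap.pi_apply_eq_sum_univ f x]
    simp only [smul_eq_mul, hc]
    congr! 4 with k
    simp [Pi.single_apply, eq_comm]
  obtain ⟨i₀, hi₀⟩ : ∃ i, c i ≠ 0 := by
    by_contra! h
    exact hf0 (LinearMap.ext fun x => by simp [hfx, h])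
  have hrel : ∀ b, ∑ i, σ (t i + b) * c i = 0 := fun b => by
    rw [← hfx]
    exact hf (Submodule.subset_span (mem_range_self b))
  -- Vanishing coefficients are dropped, since the excluded relation requires nonzero ones; `κ` may
  -- be empty, which is the case `p = 0`.
  let κ := {i // i ≠ i₀ ∧ c i ≠ 0}
  let e := Fintype.equivFin κ
  refine hσ ⟨Fintype.card κ, fun k => -(c (e.symm k) / c i₀), fun k => t i₀ - t (e.symm k),
    fun k => ?_, fun k => ?_, fun j k hjk h => ?_, fun x => ?_⟩
  · exact neg_ne_zero.2 (div_ne_zero (e.symm k).2.2 hi₀)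
  · exact sub_ne_zero.2 fun h => (e.symm k).2.1 (ht h).symm
  · exact hjk (e.symm.injective (Subtype.ext (ht (sub_right_injective h))))
  · have h := hrel (x - t i₀)
    rw [← Finset.add_sum_erase _ _ (Finset.mem_univ i₀)] at h
    have h' : ∑ k : κ, σ (t k + (x - t i₀)) * c k
        = ∑ i ∈ Finset.univ.erase i₀, σ (t i + (x - t i₀)) * c i := by
      rw [← Finset.sum_filter_of_ne (p := fun i => i ≠ i₀ ∧ c i ≠ 0)]
      · refine (Finset.sum_subtype _ (fun i => ?_) fun i => σ (t i + (x - t i₀)) * c i).symm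
        simp
      · intro i hi h
        exact ⟨Finset.ne_of_mem_erase hi, right_ne_zero_of_mul h⟩
    rw [← h', add_sub_cancel] at h
    rw [Equiv.sum_comp e.symm (fun k : κ => -(c k / c i₀) * σ (x - (t i₀ - t k)))]
    have : ∀ k : κ, -(c k / c i₀) * σ (x - (t i₀ - t k))
        = -(σ (t k + (x - t i₀)) * c k) / c i₀ := by
      intro k
      rw [show x - (t i₀ - t k) = t k + (x - t i₀) by ring]
      ring
    rw [Finset.sum_congr rfl fun k _ => this k, ← Finset.sum_div, Finset.sum_neg_distrib,
      eq_div_iff hi₀]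
    linarith

/-- On distinct samples, `N` neurons can be chosen whose outputs span `ℝ^N`. -/
theorem exists_span_neuronFeature {σ : ℝ → ℝ} (hσ : NoTranslateRelation σ)
    {X : Matrix (Fin N) (Fin d) ℝ} (hX : ∀ i j, i ≠ j → X i ≠ X j) :
    ∃ c : Fin N → (Fin d → ℝ) × ℝ,
      Submodule.span ℝ (range fun i => neuronFeature σ X (c i)) = ⊤ := by
  obtain ⟨w, hw⟩ := exists_injective_dotProduct hX
  have htop := span_translates_eq_top hσ hw
  obtain ⟨κ, a, -, hspan, hli⟩ :=
    exists_linearIndependent' ℝ fun b : ℝ => fun i => σ (X i ⬝ᵥ w + b)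
  rw [htop] at hspan
  have : Finite κ := hli.finite
  have := Fintype.ofFinite κ
  have hcard : Fintype.card κ = N := by
    rw [linearIndependent_iff_card_eq_finrank_span.1 hli, Set.finrank, hspan, finrank_top,
      Module.finrank_fin_fun]
  let e := Fintype.equivFinOfCardEq hcard
  refine ⟨fun i => (w, a (e.symm i)), ?_⟩
  rw [← hspan]
  congr 1
  exact e.symm.surjective.range_comp fun k => fun i => σ (X i ⬝ᵥ w + a k)

end Features

/-! ### The activation as a homeomorphism. -/

section Activation

theorem StrictlyMonotoneOnto.exists_homeomorph {σ : ℝ → ℝ} (h : StrictlyMonotoneOnto σ) :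
    ∃ e : ℝ ≃ₜ ℝ, ⇑e = σ := by
  obtain ⟨hmono | hanti, hr⟩ := h
  · exact ⟨(hmono.orderIsoOfSurjective σ (range_eq_univ.1 hr)).toHomeomorph, rfl⟩
  · have hmono : StrictMono fun x => σ (-x) := fun x y hxy => hanti (neg_lt_neg hxy)
    have hs : Function.Surjective fun x => σ (-x) :=
      (range_eq_univ.1 hr).comp neg_surjective
    refine ⟨(Homeomorph.neg ℝ).trans (hmono.orderIsoOfSurjective _ hs).toHomeomorph, ?_⟩
    ext x
    exact congr_arg σ (neg_neg x)

/-- A homeomorphism of `ℝ` applied entrywise. -/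
def mapHomeomorph {N q : ℕ} (e : ℝ ≃ₜ ℝ) :
    Matrix (Fin N) (Fin q) ℝ ≃ₜ Matrix (Fin N) (Fin q) ℝ where
  toFun A := A.map e
  invFun A := A.map e.symm
  left_inv A := by ext; simp
  right_inv A := by ext; simp
  continuous_toFun := continuous_id.matrix_map e.continuous
  continuous_invFun := continuous_id.matrix_map e.symm.continuous

/-- This treats the hidden layers and the last one, which has no activation, uniformly. -/
theorem exists_homeomorph_ite_map {N q : ℕ} {σ : ℝ → ℝ} (h : StrictlyMonotoneOnto σ) (p : Prop)
    [Decidable p] :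
    ∃ e : Matrix (Fin N) (Fin q) ℝ ≃ₜ Matrix (Fin N) (Fin q) ℝ,
      ∀ A, e A = if p then A else A.map σ := by
  obtain ⟨e, rfl⟩ := h.exists_homeomorph
  by_cases hp : p
  · exact ⟨Homeomorph.refl _, fun A => by simp [hp]⟩
  · exact ⟨mapHomeomorph e, fun A => by simp [hp, mapHomeomorph]⟩

end Activation

/-! ### Lifting curves through the layers. -/

section Layers

variable {N L : ℕ} {n : ℕ → ℕ}

/-- The matrix `1 bᵀ` all of whose rows are `b`. -/
def biasRows {q : ℕ} (N : ℕ) (b : Fin q → ℝ) : Matrix (Fin N) (Fin q) ℝ :=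
  Matrix.of fun _ j => b j

theorem Continuous.biasRows {Y : Type*} [TopologicalSpace Y] {q : ℕ} {b : Y → Fin q → ℝ}
    (hb : Continuous b) : Continuous fun y => biasRows N (b y) :=
  continuous_matrix fun _ j => (continuous_apply j).comp hb

theorem layerOutput_succ (σ : ℝ → ℝ) (X : Matrix (Fin N) (Fin (n 0)) ℝ) (θ : Params L n) {k : ℕ}
    (h : k + 1 ≤ L) :
    layerOutput σ X θ (k + 1) h =
      if k + 1 = L then
        layerOutput σ X θ k (Nat.le_of_succ_le h) * (θ ⟨k, h⟩).1 + biasRows N (θ ⟨k, h⟩).2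
      else
        (layerOutput σ X θ k (Nat.le_of_succ_le h) * (θ ⟨k, h⟩).1
          + biasRows N (θ ⟨k, h⟩).2).map σ :=
  rfl

theorem layerOutput_congr {σ : ℝ → ℝ} {X : Matrix (Fin N) (Fin (n 0)) ℝ} {θ θ' : Params L n}
    {j : ℕ} (hj : j ≤ L) (h : layerOutput σ X θ j hj = layerOutput σ X θ' j hj)
    (hθ : ∀ l : Fin L, j ≤ l → θ l = θ' l) (k : ℕ) (hjk : j ≤ k) (hk : k ≤ L) :
    layerOutput σ X θ k hk = layerOutput σ X θ' k hk := by
  induction k, hjk using Nat.le_induction with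
  | base => exact h
  | succ k hjk ih => rw [layerOutput_succ, layerOutput_succ, ih, hθ ⟨k, hk⟩ hjk]

/-- The pullback of a curve-connected set along a layer of decreasing width is curve-connected. -/
theorem CurveConnected.layer_preimage {l : Fin L} (hl : n (l + 1) < n l)
    (act : Matrix (Fin N) (Fin (n (l + 1))) ℝ ≃ₜ Matrix (Fin N) (Fin (n (l + 1))) ℝ)
    {T : Set (Matrix (Fin N) (Fin (n (l + 1))) ℝ × Params L n)} (hT : CurveConnected T)
    (hTl : ∀ F θ x, (F, θ) ∈ T → (F, Function.update θ l x) ∈ T) :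
    CurveConnected {x : Matrix (Fin N) (Fin (n l)) ℝ × Params L n |
      (act (x.1 * (x.2 l).1 + biasRows N (x.2 l).2), x.2) ∈ T} := by
  set T' := {x : Matrix (Fin N) (Fin (n l)) ℝ × Params L n |
      (act (x.1 * (x.2 l).1 + biasRows N (x.2 l).2), x.2) ∈ T} with hT'
  have key : ∀ x ∈ T', ∃ y, JoinedIn T' x y ∧ Function.Injective (y.2 l).1.mulVec := by
    rintro ⟨F, θ⟩ hx
    obtain ⟨F', W', hW', hJ⟩ := exists_joinedIn_injective hl.le F (θ l).1
    have := JoinedIn.map_of_mapsTo hJ (T := T')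
      (f := fun y => (y.1, Function.update θ l (y.2, (θ l).2))) (by fun_prop) (by
        intro y hy
        rw [mem_ofPred_eq] at hy
        simp only [hT', mem_ofPred_eq, Function.update_self, hy]
        exact hTl _ _ _ hx)
    rw [show ((θ l).1, (θ l).2) = θ l from rfl, Function.update_eq_self] at this
    exact ⟨_, this, by simpa using hW'⟩
  have main : ∀ x ∈ T', ∀ y ∈ T', Function.Injective (x.2 l).1.mulVec →
      Function.Injective (y.2 l).1.mulVec → JoinedIn T' x y := by
    rintro ⟨F, θ⟩ hx ⟨F', θ'⟩ hy hW hW'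
    obtain ⟨w, hwc, hw0, hw1, hw⟩ :=
      joinedIn_iff_exists_continuous.1 (joinedIn_injective_mulVec hl hW hW')
    obtain ⟨γ, hγc, hγ0, hγ1, hγ⟩ := joinedIn_iff_exists_continuous.1 (hT _ hx _ hy)
    let b : ℝ → Fin (n (l + 1)) → ℝ := fun t => (θ l).2 + t • ((θ' l).2 - (θ l).2)
    let G : ℝ → Matrix (Fin N) (Fin (n l)) ℝ := fun t => F + t • (F' - F)
    have hb : Continuous b := by fun_prop
    have hG : Continuous G := by fun_prop
    -- The straight line `G` is corrected by the residual times a left inverse of `w t`, so that the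
    -- layer output is exactly `(γ t).1`. At both endpoints the residual vanishes, so the endpoints
    -- are the given ones.
    refine joinedIn_iff_exists_continuous.2 ⟨fun t =>
      (G t + (act.symm (γ t).1 - biasRows N (b t) - G t * w t) * leftInv (w t),
        Function.update (γ t).2 l (w t, b t)), ?_, ?_, ?_, fun t => ?_⟩
    · have h1 : Continuous fun t => act.symm (γ t).1 := act.symm.continuous.comp hγc.fst
      have h2 := ((h1.sub (Continuous.biasRows hb)).sub (hG.matrix_mul hwc)).matrix_mul
        (continuous_leftInv hwc hw)
      exact (hG.add h2).prodMk (hγc.snd.update l (hwc.prodMk hb))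
    · have : (w 0, b 0) = θ l := by simp [b, hw0]
      beta_reduce
      rw [this, hγ0]
      simp [G, b, hw0]
    · have : (w 1, b 1) = θ' l := by simp [b, hw1]
      beta_reduce
      rw [this, hγ1]
      simp [G, b, hw1]
    · have h1 : (G t + (act.symm (γ t).1 - biasRows N (b t) - G t * w t) * leftInv (w t)) * w t
          + biasRows N (b t) = act.symm (γ t).1 := by
        rw [Matrix.add_mul, Matrix.mul_assoc, leftInv_mul (hw t), Matrix.mul_one]
        abel
      simp only [hT', mem_ofPred_eq, Function.update_self, h1, Homeomorph.apply_symm_apply]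
      exact hTl _ _ _ (hγ t)
  intro x hx y hy
  obtain ⟨x', hxx', hx'⟩ := key x hx
  obtain ⟨y', hyy', hy'⟩ := key y hy
  exact hxx'.trans ((main _ hxx'.target_mem _ hyy'.target_mem hx' hy').trans hyy'.symm)

/-- The parameters of the first layer given neuron by neuron. -/
def ofNeurons {d p : ℕ} (P : Fin p → (Fin d → ℝ) × ℝ) : Matrix (Fin d) (Fin p) ℝ × (Fin p → ℝ) :=
  (Matrix.of fun i k => (P k).1 i, fun k => (P k).2)

/-- The neurons of a layer. -/
def toNeurons {d p : ℕ} (x : Matrix (Fin d) (Fin p) ℝ × (Fin p → ℝ)) : Fin p → (Fin d → ℝ) × ℝ :=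
  fun k => (x.1.col k, x.2 k)

theorem ofNeurons_toNeurons {d p : ℕ} (x : Matrix (Fin d) (Fin p) ℝ × (Fin p → ℝ)) :
    ofNeurons (toNeurons x) = x :=
  rfl

theorem continuous_ofNeurons {d p : ℕ} :
    Continuous (ofNeurons : (Fin p → (Fin d → ℝ) × ℝ) → _) := by
  refine Continuous.prodMk (continuous_matrix fun i k => ?_) (continuous_pi fun k => ?_)
  · simp only [of_apply]
    fun_prop
  · fun_prop

/-- Replace the neurons of the first layer and the weights of the second one. -/
def replaceFirst (hL : 2 ≤ L) (θ : Params L n)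
    (x : (Fin (n 1) → (Fin (n 0) → ℝ) × ℝ) × Matrix (Fin (n 1)) (Fin (n 2)) ℝ) : Params L n :=
  Function.update (Function.update θ ⟨0, by omega⟩ (ofNeurons x.1)) ⟨1, hL⟩ (x.2, (θ ⟨1, hL⟩).2)

theorem continuous_replaceFirst (hL : 2 ≤ L) (θ : Params L n) :
    Continuous (replaceFirst hL θ) :=
  (continuous_const.update _ (continuous_ofNeurons.comp continuous_fst)).update _
    (continuous_snd.prodMk continuous_const)

theorem replaceFirst_self (hL : 2 ≤ L) (θ : Params L n) :
    replaceFirst hL θ (toNeurons (θ ⟨0, by omega⟩), (θ ⟨1, hL⟩).1) = θ := by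
  rw [replaceFirst, ofNeurons_toNeurons, Function.update_eq_self]
  exact Function.update_eq_self _ _

theorem layerOutput_one (hL : 2 ≤ L) (σ : ℝ → ℝ) (X : Matrix (Fin N) (Fin (n 0)) ℝ)
    (θ : Params L n) :
    layerOutput σ X θ 1 (by omega)
      = featureMatrix (neuronFeature σ X) (toNeurons (θ ⟨0, by omega⟩)) := by
  rw [layerOutput_succ, if_neg (by omega)]
  rfl

theorem layerOutput_two_eq (hL : 2 ≤ L) {σ : ℝ → ℝ} {X : Matrix (Fin N) (Fin (n 0)) ℝ}
    {act : Matrix (Fin N) (Fin (n 2)) ℝ → Matrix (Fin N) (Fin (n 2)) ℝ}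
    (hact : ∀ A, act A = if 1 + 1 = L then A else A.map σ) (θ : Params L n) :
    layerOutput σ X θ 2 hL
      = act (featureMatrix (neuronFeature σ X) (toNeurons (θ ⟨0, by omega⟩)) * (θ ⟨1, hL⟩).1
        + biasRows N (θ ⟨1, hL⟩).2) := by
  rw [hact, layerOutput_succ, layerOutput_one hL]

theorem layerOutput_two_replaceFirst (hL : 2 ≤ L) {σ : ℝ → ℝ}
    {X : Matrix (Fin N) (Fin (n 0)) ℝ} (θ : Params L n)
    {x : (Fin (n 1) → (Fin (n 0) → ℝ) × ℝ) × Matrix (Fin (n 1)) (Fin (n 2)) ℝ}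
    (hx : featureMatrix (neuronFeature σ X) x.1 * x.2
      = featureMatrix (neuronFeature σ X) (toNeurons (θ ⟨0, by omega⟩)) * (θ ⟨1, hL⟩).1) :
    layerOutput σ X (replaceFirst hL θ x) 2 hL = layerOutput σ X θ 2 hL := by
  rw [layerOutput_two_eq hL (fun _ => rfl), layerOutput_two_eq hL (fun _ => rfl), ← hx]
  simp [replaceFirst]
  rfl

/-- The pullback of a curve-connected set along the first two layers is curve-connected. -/
theorem CurveConnected.first_layers_preimage (hL : 2 ≤ L) (hn₁ : 2 * N ≤ n 1) {σ : ℝ → ℝ}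
    (hσ₁ : StrictlyMonotoneOnto σ) (hσ₂ : NoTranslateRelation σ)
    {X : Matrix (Fin N) (Fin (n 0)) ℝ} (hX : ∀ i j, i ≠ j → X i ≠ X j)
    {T : Set (Matrix (Fin N) (Fin (n 2)) ℝ × Params L n)} (hT : CurveConnected T)
    (hTl : ∀ l : Fin L, (l : ℕ) < 2 → ∀ F θ x, (F, θ) ∈ T → (F, Function.update θ l x) ∈ T) :
    CurveConnected {θ : Params L n | (layerOutput σ X θ 2 hL, θ) ∈ T} := by
  set T' := {θ : Params L n | (layerOutput σ X θ 2 hL, θ) ∈ T} with hT'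
  obtain ⟨act, hact⟩ := exists_homeomorph_ite_map (N := N) (q := n 2) hσ₁ (1 + 1 = L)
  obtain ⟨c, hc⟩ := exists_span_neuronFeature hσ₂ hX
  let e₀ : Fin N → Fin (n 1) := Fin.castLE (by omega)
  have he₀ : Function.Injective e₀ := Fin.castLE_injective _
  set P₀ : Fin (n 1) → (Fin (n 0) → ℝ) × ℝ := Function.extend e₀ c 0 with hP₀
  let l₀ : Fin L := ⟨0, by omega⟩
  let l₁ : Fin L := ⟨1, hL⟩
  set Y := featureMatrix (neuronFeature σ X) P₀ with hY
  -- The columns of `Y` at `e₀` are the spanning features, so `Y` is surjective.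
  obtain ⟨Z, hZ⟩ : ∃ Z : Matrix (Fin (n 1)) (Fin N) ℝ, Y * Z = 1 := by
    refine Matrix.mulVec_surjective_iff_exists_right_inverse.1 ?_
    rw [← Matrix.coe_mulVecLin, ← LinearMap.range_eq_top, Matrix.range_mulVecLin, eq_top_iff,
      ← hc]
    refine Submodule.span_mono ?_
    rintro _ ⟨i, rfl⟩
    refine ⟨e₀ i, ?_⟩
    ext j
    simp [hY, hP₀, featureMatrix, he₀.extend_apply]
  have key : ∀ θ ∈ T', ∃ θ', JoinedIn T' θ θ' ∧ θ' l₀ = ofNeurons P₀ := by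
    intro θ hθ
    obtain ⟨W, hJ⟩ := exists_joinedIn_extend (neuronFeature σ X) hc hn₁ he₀ (toNeurons (θ l₀))
      (θ l₁).1
    have := JoinedIn.map_of_mapsTo hJ (T := T') (continuous_replaceFirst hL θ) (by
      intro y hy
      simp only [hT', mem_ofPred_eq, layerOutput_two_replaceFirst hL θ hy]
      exact hTl _ (by simp) _ _ _ (hTl _ (by simp) _ _ _ hθ))
    rw [replaceFirst_self] at this
    refine ⟨_, this, ?_⟩
    simp [replaceFirst, l₀, P₀]
  have main : ∀ θ ∈ T', ∀ θ' ∈ T', θ l₀ = ofNeurons P₀ → θ' l₀ = ofNeurons P₀ →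
      JoinedIn T' θ θ' := by
    intro θ hθ θ' hθ' h₀ h₀'
    obtain ⟨γ, hγc, hγ0, hγ1, hγ⟩ := joinedIn_iff_exists_continuous.1 (hT _ hθ _ hθ')
    let b : ℝ → Fin (n 2) → ℝ := fun t => (θ l₁).2 + t • ((θ' l₁).2 - (θ l₁).2)
    let w : ℝ → Matrix (Fin (n 1)) (Fin (n 2)) ℝ := fun t =>
      (θ l₁).1 + t • ((θ' l₁).1 - (θ l₁).1)
    have hb : Continuous b := by fun_prop
    have hw : Continuous w := by fun_prop
    have hout : ∀ θ : Params L n, θ l₀ = ofNeurons P₀ →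
        layerOutput σ X θ 2 hL = act (Y * (θ l₁).1 + biasRows N (θ l₁).2) := by
      intro θ h
      rw [layerOutput_two_eq hL hact, show θ ⟨0, _⟩ = _ from h]
      rfl
    -- With the first layer frozen at `P₀`, the interpolated second weights are corrected by `Z`
    -- times the residual, which again vanishes at the endpoints.
    refine joinedIn_iff_exists_continuous.2 ⟨fun t =>
      Function.update (Function.update (γ t).2 l₀ (ofNeurons P₀)) l₁
        (w t + Z * (act.symm (γ t).1 - biasRows N (b t) - Y * w t), b t), ?_, ?_, ?_, fun t => ?_⟩
    · have h1 : Continuous fun t => act.symm (γ t).1 := act.symm.continuous.comp hγc.fst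
      have h2 := continuous_const (y := Z).matrix_mul
        ((h1.sub (Continuous.biasRows hb)).sub (continuous_const (y := Y).matrix_mul hw))
      exact (hγc.snd.update l₀ continuous_const).update l₁ ((hw.add h2).prodMk hb)
    · have : (w 0 + Z * (act.symm (γ 0).1 - biasRows N (b 0) - Y * w 0), b 0) = θ l₁ := by
        rw [hγ0, hout θ h₀]
        simp [w, b]
      beta_reduce
      rw [this, hγ0, ← h₀]
      simp
    · have : (w 1 + Z * (act.symm (γ 1).1 - biasRows N (b 1) - Y * w 1), b 1) = θ' l₁ := by
        rw [hγ1, hout θ' h₀']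
        simp [w, b]
      beta_reduce
      rw [this, hγ1, ← h₀']
      simp
    · rw [hT', mem_ofPred_eq, hout _ (by simp [l₀, l₁])]
      have h1 : Y * (w t + Z * (act.symm (γ t).1 - biasRows N (b t) - Y * w t))
          + biasRows N (b t) = act.symm (γ t).1 := by
        rw [Matrix.mul_add, ← Matrix.mul_assoc, hZ, Matrix.one_mul]
        abel
      beta_reduce
      rw [Function.update_self, h1, Homeomorph.apply_symm_apply]
      exact hTl _ (by simp [l₁]) _ _ _ (hTl _ (by simp [l₀]) _ _ _ (hγ t))
  intro x hx y hy
  obtain ⟨x', hxx', hx'⟩ := key x hx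
  obtain ⟨y', hyy', hy'⟩ := key y hy
  exact hxx'.trans ((main _ hxx'.target_mem _ hyy'.target_mem hx' hy').trans hyy'.symm)

/-- Induction on `k`, peeling off the top layer. The invariance `hTl` lets lower parameters be
rewritten during a lift, and it passes to the pullback because layer `k + 1` only involves the
parameter of index `k`. -/
theorem CurveConnected.layerOutput_preimage (hL : 2 ≤ L) (hn₁ : 2 * N ≤ n 1)
    (hn : StrictAntiOn n (Set.Icc 2 L)) {σ : ℝ → ℝ}
    (hσ₁ : StrictlyMonotoneOnto σ) (hσ₂ : NoTranslateRelation σ)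
    {X : Matrix (Fin N) (Fin (n 0)) ℝ} (hX : ∀ i j, i ≠ j → X i ≠ X j) (k : ℕ) (h2k : 2 ≤ k)
    (hk : k ≤ L) {T : Set (Matrix (Fin N) (Fin (n k)) ℝ × Params L n)} (hT : CurveConnected T)
    (hTl : ∀ l : Fin L, (l : ℕ) < k → ∀ F θ x, (F, θ) ∈ T → (F, Function.update θ l x) ∈ T) :
    CurveConnected {θ : Params L n | (layerOutput σ X θ k hk, θ) ∈ T} := by
  induction k, h2k using Nat.le_induction with
  | base => exact CurveConnected.first_layers_preimage hL hn₁ hσ₁ hσ₂ hX hT hTl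
  | succ k h2k ih =>
    obtain ⟨act, hact⟩ := exists_homeomorph_ite_map (N := N) (q := n (k + 1)) hσ₁ (k + 1 = L)
    have h1 := CurveConnected.layer_preimage (l := ⟨k, hk⟩)
      (hn ⟨h2k, Nat.le_of_succ_le hk⟩ ⟨h2k.trans k.le_succ, hk⟩ (Nat.lt_succ_self k)) act hT
      (hTl ⟨k, hk⟩ (Nat.lt_succ_self k))
    have h2 := ih (Nat.le_of_succ_le hk) h1 (fun l hl F θ x h => by
      have hne : (⟨k, hk⟩ : Fin L) ≠ l := fun h => by simp [← h] at hl
      simp only [mem_ofPred_eq, Function.update_of_ne hne] at h ⊢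
      exact hTl l (by omega) _ _ _ h)
    convert h2 using 3
    rw [layerOutput_succ, mem_ofPred_eq, hact]

/-- Preimages of convex sets under the network map are curve-connected. -/
theorem curveConnected_network_preimage (hL : 2 ≤ L) (hn₁ : 2 * N ≤ n 1)
    (hn : StrictAntiOn n (Set.Icc 2 L)) {σ : ℝ → ℝ}
    (hσ₁ : StrictlyMonotoneOnto σ) (hσ₂ : NoTranslateRelation σ)
    {X : Matrix (Fin N) (Fin (n 0)) ℝ} (hX : ∀ i j, i ≠ j → X i ≠ X j)
    {S : Set (Matrix (Fin N) (Fin (n L)) ℝ)} (hS : Convex ℝ S) :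
    CurveConnected {θ : Params L n | layerOutput σ X θ L le_rfl ∈ S} := by
  have hT : CurveConnected {x : Matrix (Fin N) (Fin (n L)) ℝ × Params L n | x.1 ∈ S} := by
    intro x hx y hy
    have hc : Convex ℝ {x : Matrix (Fin N) (Fin (n L)) ℝ × Params L n | x.1 ∈ S} :=
      hS.linear_preimage (LinearMap.fst ℝ _ _)
    exact (hc.isPathConnected ⟨x, hx⟩).joinedIn x hx y hy
  exact hT.layerOutput_preimage hL hn₁ hn hσ₁ hσ₂ hX L hL le_rfl fun l _ F θ x h => h

/-- The redundant neuron is moved to weights `0` and bias `R`. The second layer output stays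
constant, hence so does the loss. -/
theorem exists_joinedIn_levelSet_bias (hL : 2 ≤ L) (hn₁ : N < n 1) (σ : ℝ → ℝ)
    (X : Matrix (Fin N) (Fin (n 0)) ℝ) (φ : Matrix (Fin N) (Fin (n L)) ℝ → ℝ) (θ : Params L n)
    (R : ℝ) :
    ∃ (θ' : Params L n) (j : Fin (n 1)), (θ' ⟨0, by omega⟩).2 j = R ∧
      JoinedIn (levelSet (loss σ X φ) (loss σ X φ θ)) θ θ' := by
  obtain ⟨k, hk⟩ := exists_joinedIn_row_eq_zero (neuronFeature σ X) hn₁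
    (toNeurons (θ ⟨0, by omega⟩)) (θ ⟨1, hL⟩).1
  obtain ⟨W', hJ⟩ := hk (0, R)
  have := JoinedIn.map_of_mapsTo hJ (T := levelSet (loss σ X φ) (loss σ X φ θ))
    (continuous_replaceFirst hL θ) (by
      intro y hy
      refine congr_arg φ (layerOutput_congr hL (layerOutput_two_replaceFirst hL θ hy) ?_ L hL _)
      intro l hl
      rw [replaceFirst, Function.update_of_ne, Function.update_of_ne] <;>
      · rintro rfl
        simp at hl)
  rw [replaceFirst_self] at this
  exact ⟨_, k, by simp [replaceFirst, ofNeurons], this⟩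

end Layers

/-! ### Maximal connected subsets. -/

section Components

variable {E : Type*} [TopologicalSpace E] {S C : Set E}

/-- The path component of `x` in `S` contains `C`, so maximality makes it lie in `C`. -/
theorem IsComponent.mem_of_joinedIn (hC : IsComponent S C) {x y : E} (hx : x ∈ C)
    (hxy : JoinedIn S x y) : y ∈ C := by
  refine hC.2.2 (y := pathComponentIn S x) ⟨pathComponentIn_subset, ?_⟩ ?_ hxy
  · exact (isPathConnected_pathComponentIn hxy.source_mem).joinedIn
  · exact fun z hz => (hC.2.1.2 x hx z hz).mono hC.2.1.1

theorem IsComponent.eq_of_curveConnected (hC : IsComponent S C) (hS : CurveConnected S) : C = S :=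
  hC.2.1.1.antisymm (hC.2.2 ⟨Subset.rfl, hS⟩ hC.2.1.1)

end Components

end DeepNet
-- The main theorem.
theorem theorem3
    (N L : ℕ) (hN : 1 ≤ N) (hL : 2 ≤ L) (n : ℕ → ℕ)
    (hn₁ : 2 * N ≤ n 1) (hn : StrictAntiOn n (Set.Icc 2 L))
    (σ : ℝ → ℝ) (hσ : Continuous σ)
    (hσ₁ : DeepNet.StrictlyMonotoneOnto σ) (hσ₂ : DeepNet.NoTranslateRelation σ)
    (X : Matrix (Fin N) (Fin (n 0)) ℝ) (hX : ∀ i j, i ≠ j → X i ≠ X j)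
    (φ : Matrix (Fin N) (Fin (n L)) ℝ → ℝ) (hφ : ConvexOn ℝ Set.univ φ) :
    -- every sublevel set is connected
    (∀ α : ℝ, DeepNet.CurveConnected
      (DeepNet.sublevelSet (DeepNet.loss (L := L) (n := n) σ X φ) α)) ∧
    -- every connected component of every level set is unbounded
    (∀ (α : ℝ) (C : Set (DeepNet.Params L n)),
      DeepNet.IsComponent (DeepNet.levelSet (DeepNet.loss σ X φ) α) C →
        ¬ DeepNet.BoundedParams C) ∧
    -- the global minima are connected, and at each level there is at most one valley
    -- (connected component of the strict sublevel set), which contains all of them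
    DeepNet.CurveConnected (DeepNet.globalMinima (DeepNet.loss (L := L) (n := n) σ X φ)) ∧
    (∀ (α : ℝ) (V : Set (DeepNet.Params L n)),
      DeepNet.IsComponent (DeepNet.strictSublevelSet (DeepNet.loss σ X φ) α) V →
        DeepNet.globalMinima (DeepNet.loss σ X φ) ⊆ V ∧
        ∀ V' : Set (DeepNet.Params L n),
          DeepNet.IsComponent (DeepNet.strictSublevelSet (DeepNet.loss σ X φ) α) V' →
            V' = V) := by

  have hpre : ∀ {S : Set (Matrix (Fin N) (Fin (n L)) ℝ)}, Convex ℝ S →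
      DeepNet.CurveConnected
        {θ : DeepNet.Params L n | DeepNet.layerOutput σ X θ L le_rfl ∈ S} :=
    fun hS => DeepNet.curveConnected_network_preimage hL hn₁ hn hσ₁ hσ₂ hX hS
  have hsub : ∀ α, DeepNet.CurveConnected
      (DeepNet.sublevelSet (DeepNet.loss (L := L) (n := n) σ X φ) α) := fun α =>
    hpre (S := {A | φ A ≤ α}) (by simpa using hφ.convex_le α)
  have hlt : ∀ α, DeepNet.CurveConnected
      (DeepNet.strictSublevelSet (DeepNet.loss (L := L) (n := n) σ X φ) α) := fun α =>
    hpre (S := {A | φ A < α}) (by simpa using hφ.convex_lt α)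
  refine ⟨hsub, ?_, ?_, ?_⟩
  · rintro α C hC ⟨R, hR⟩
    obtain ⟨θ, hθ⟩ := hC.1
    -- `N ≥ 1` turns `2 * N ≤ n 1` into `N < n 1`; a bias equal to `R + 1` violates the bound `R`.
    obtain ⟨θ', j, hj, hJ⟩ := DeepNet.exists_joinedIn_levelSet_bias hL (by omega) σ X φ θ (R + 1)
    rw [show DeepNet.loss σ X φ θ = α from hC.2.1.1 hθ] at hJ
    have := (hR θ' (hC.mem_of_joinedIn hθ hJ) ⟨0, by omega⟩).2 j
    rw [hj] at this
    linarith [le_abs_self (R + 1)]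
  · intro x hx y hy
    -- At a minimizer `x`, the sublevel set at the value `Φ x` consists of global minimizers.
    exact (hsub (DeepNet.loss σ X φ x) x (le_refl (DeepNet.loss σ X φ x)) y (hy x)).mono fun z hz θ' => le_trans hz (hx θ')
  · intro α V hV
    have hVS := hV.eq_of_curveConnected (hlt α)
    refine ⟨fun θ hθ => ?_, fun V' hV' => (hV'.eq_of_curveConnected (hlt α)).trans hVS.symm⟩
    obtain ⟨θ', hθ'⟩ := hV.1
    rw [hVS] at hθ' ⊢
    exact lt_of_le_of_lt (hθ θ') hθ'
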